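/- **Theorem (simulation of Turing machines).** *Lambda-calculus.* Consider untyped lambda terms $M ::= x \mid \lambda x.M \mid MM$ up to $\alpha$-equivalence; values are variables and abstractions. Call-by-value reduction $\rightarrow$ is the rule $(\lambda x.M)V\rightarrow M\{V/x\}$, with $V$ a value, closed under all applicative contexts (never under an abstraction). Let $|M|$ be the number of symbols of $M$: $|x|=1$, $|\lambda x.M|=|M|+1$, $|MN|=|M|+|N|+1$. For $\alpha\in\mathbb{N}^*$ write $M\stackrel{\alpha}{\twoheadrightarrow}N$ if $M=M_0\rightarrow M_1\rightarrow\cdots\rightarrow M_m=N$ and $\alpha=(n_1,\ldots,n_m)$ with $n_i=\max\{1,|M_i|-|M_{i-1}|\}$; put $\|\alpha\|=n_1+\cdots+n_m$, the total difference cost of the reduction. Strings over an alphabet $\Delta=\{a_1,\ldots,a_n\}$ (enumerated in a fixed order) have the Scott encoding $$\ulcorner\varepsilon\urcorner=\lambda x_1.\ldots.\lambda x_n.\lambda y.y,\qquad \ulcorner a_iu\urcorner=\lambda x_1.\ldots.\lambda x_n.\lambda y.x_i\,\ulcorner u\urcorner .$$ *Turing machines.* A deterministic Turing machine $\mathcal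 M$ has a finite alphabet $\Sigma$ with a blank symbol, a finite set $Q$ of states with an initial and a final state, and a partial transition function $\delta:Q\times\Sigma\rightharpoonup Q\times\Sigma\times\{\leftarrow,\rightarrow,\downarrow\}$ such that $\delta(q,a)$ is defined iff $q$ is not the final state. A configuration is a quadruple $(w,a,v,q)\in\Sigma^*\times\Sigma\times\Sigma^*\times Q$ (tape left of the head, scanned symbol, tape right of the head, state). It evolves by writing a symbol, changing the state and moving the head as $\delta(q,a)$ prescribes, the head finding a blank when it moves beyond an end of the tape. The initial configuration for $u$ is $(\varepsilon,a,v,q_{\mathit{initial}})$ if $u=av$, and $(\varepsilon,a_{\mathit{blank}},\varepsilon,q_{\mathit{initial}})$ if $u=\varepsilon$. For $\Delta\subseteq\Sigma$, $\mathcal M$ computes $f:\Delta^*\to\Delta^*$ in time $g:\mathbb N\to\mathbb N$ if for every $u\in\Delta^*$ the initial configuration for $u$ evolves, in at most $g(|u|)$ steps, to a configuration $(w,a,v,q_{\mathit{final}})$ such that deleting from $wav$ all symbols outside $\Delta$ gives $f(u)$. *Claim.* For every deterministic Turing machine $\mathcal M$ with alphabet $\Sigma$ and every $\Delta\subseteq\Sigma$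 there are a lambda term $F_{\mathcal M}^{\Delta}$ and a constant $K$, depending only on $\mathcal M$ and $\Delta$, such that whenever $\mathcal M$ computes $f:\Delta^*\to\Delta^*$ in time $g$, for every $u\in\Delta^*$ there is $\alpha\in\mathbb{N}^*$ with $$F_{\mathcal M}^{\Delta}\,\ulcorner u\urcorner\stackrel{\alpha}{\twoheadrightarrow}\ulcorner f(u)\urcorner\qquad\text{and}\qquad \|\alpha\|\le K\cdot\max\{1,g(|u|)\}.$$ In particular $\|\alpha\|=O(g(|u|))$ if $g\geq 1$: the simulation has only linear overhead. -/

import Mathlib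

namespace LambdaCost

/-! ## The weak call-by-value lambda-calculus -/

/-- Untyped lambda terms up to alpha-equivalence, with de Bruijn indices counted from `0`. -/
inductive Term : Type
  | var : ℕ → Term
  | lam : Term → Term
  | app : Term → Term → Term

namespace Term

/-- Values are variables and abstractions. -/
inductive IsValue : Term → Prop
  | var (i : ℕ) : IsValue (var i)
  | lam (M : Term) : IsValue (lam M)

/-- The length `|M|`: the number of symbols of `M`, one for each occurrence of a variable, each
abstraction and each application. -/
def size : Term → ℕ
  | var _ => 1
  | lam M => size M + 1
  | app M N => size M + size N + 1

/-- `shift c M` increments the indices `≥ c` in `M`: the weakening of `M` by a fresh variable. -/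
def shift : ℕ → Term → Term
  | c, var i => if i < c then var i else var (i + 1)
  | c, lam M => lam (shift (c + 1) M)
  | c, app M N => app (shift c M) (shift c N)

/-- `subst k V M` is the capture-avoiding substitution of `V` for the variable with index `k` in
`M`; that variable disappears from the context, so larger indices are decremented. -/
def subst : ℕ → Term → Term → Term
  | k, V, var i => if i < k then var i else if i = k then V else var (i - 1)
  | k, V, lam M => lam (subst (k + 1) (shift 0 V) M)
  | k, V, app M N => app (subst k V M) (subst k V N)

/-- Call-by-value reduction: the rule `(λx.M)V → M{V/x}` for values `V`, closed under all
applicative contexts (and not under abstractions). -/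
inductive Red : Term → Term → Prop
  | beta {M V : Term} : IsValue V → Red (app (lam M) V) (subst 0 V M)
  | appLeft {M M' N : Term} : Red M M' → Red (app M N) (app M' N)
  | appRight {M N N' : Term} : Red N N' → Red (app M N) (app M N')

/-- Weighted reduction: `WRed M α N` says that `M` reduces to `N` and that `α` lists the costs
`max {1, |N'| - |M'|}` of the successive steps `M' → N'`. (The subtraction may truncate at `0`,
because of the maximum with `1`.) -/
inductive WRed : Term → List ℕ → Term → Prop
  | refl (M : Term) : WRed M [] M
  | single {M N : Term} : Red M N → WRed M [max 1 (size N - size M)] N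
  | trans {M N L : Term} {α β : List ℕ} : WRed M α N → WRed N β L → WRed M (α ++ β) L

/-- The Scott encoding of strings over an alphabet `A = {a₁, …, aₙ}`, enumerated by `e`:
`⌜ε⌝ = λx₁.….λxₙ.λy.y` and `⌜aᵢu⌝ = λx₁.….λxₙ.λy.xᵢ⌜u⌝`.
Under these binders `y` has index `0`, and the variable belonging to the letter `a` has index
`n - e a`, as `e` counts from `0`. The encodings are closed, so `⌜u⌝` needs no shift. -/
def encode {A : Type*} {n : ℕ} (e : A ≃ Fin n) : List A → Term
  | [] => lam^[n + 1] (var 0)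
  | a :: u => lam^[n + 1] (app (var (n - (e a : ℕ))) (encode e u))

end Term

/-! ## Deterministic Turing machines -/

/-- The moves of the head. -/
inductive Move : Type
  | left
  | right
  | stay

/-- Deterministic single-tape Turing machines with alphabet `S` and set of states `Q`. -/
structure TuringMachine (S Q : Type*) where
  blank : S
  initialState : Q
  finalState : Q
  /-- The partial transition function. -/
  δ : Q → S → Option (Q × S × Move)
  /-- The transition function is defined exactly on the non-final states. -/
  δ_isSome_iff : ∀ q a, (δ q a).isSome ↔ q ≠ finalState

/-- A configuration `(u, a, v, q)`: the tape to the left of the head (in reading order), the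
scanned symbol, the tape to the right of the head, and the state. -/
structure Config (S Q : Type*) where
  left : List S
  head : S
  right : List S
  state : Q

namespace TuringMachine

variable {S Q : Type*}

/-- One step of computation; the head finds a blank beyond either end of the tape. -/
inductive Step (M : TuringMachine S Q) : Config S Q → Config S Q → Prop
  | stay {u v : List S} {a b : S} {q p : Q} :
      M.δ q a = some (p, b, Move.stay) → Step M ⟨u, a, v, q⟩ ⟨u, b, v, p⟩
  | left {u v : List S} {a b c : S} {q p : Q} :
      M.δ q a = some (p, b, Move.left) → Step M ⟨u ++ [c], a, v, q⟩ ⟨u, c, b :: v, p⟩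
  | leftEnd {v : List S} {a b : S} {q p : Q} :
      M.δ q a = some (p, b, Move.left) → Step M ⟨[], a, v, q⟩ ⟨[], M.blank, b :: v, p⟩
  | right {u v : List S} {a b c : S} {q p : Q} :
      M.δ q a = some (p, b, Move.right) → Step M ⟨u, a, c :: v, q⟩ ⟨u ++ [b], c, v, p⟩
  | rightEnd {u : List S} {a b : S} {q p : Q} :
      M.δ q a = some (p, b, Move.right) → Step M ⟨u, a, [], q⟩ ⟨u ++ [b], M.blank, [], p⟩

/-- `Evolves M k C D`: the configuration `C` evolves to `D` in exactly `k` steps. -/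
inductive Evolves (M : TuringMachine S Q) : ℕ → Config S Q → Config S Q → Prop
  | refl (C : Config S Q) : Evolves M 0 C C
  | step {k : ℕ} {C D E : Config S Q} : Step M C D → Evolves M k D E → Evolves M (k + 1) C E

/-- The initial configuration for a string. -/
def initialConfig (M : TuringMachine S Q) : List S → Config S Q
  | [] => ⟨[], M.blank, [], M.initialState⟩
  | a :: v => ⟨[], a, v, M.initialState⟩

/-- `M` computes `f : Δ* → Δ*`, where `Δ ⊆ S`, in time `g`: on every input `u ∈ Δ*` the machine
reaches, within `g |u|` steps, a final configuration `(w, a, v, q)` whose tape contents `w a v`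
become `f u` when the symbols outside `Δ` are dropped (none are dropped if `w a v` is already a
string over `Δ`). -/
def ComputesInTime [DecidableEq S] (M : TuringMachine S Q) (Δ : Finset S)
    (f : List Δ → List Δ) (g : ℕ → ℕ) : Prop :=
  ∀ u : List Δ, ∃ k ≤ g u.length, ∃ C : Config S Q,
    M.Evolves k (M.initialConfig (u.map Subtype.val)) C ∧ C.state = M.finalState ∧
    (C.left ++ C.head :: C.right).filter (· ∈ Δ) = (f u).map Subtype.val

end TuringMachine

end LambdaCost

/-!
A Turing machine is simulated by a program on three stacks, and such a program is compiled to a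
lambda term.

The stacks hold the tape to the left of the head, the part of the tape to the right of the head that
the machine has visited, and the rest of the input. The time `g` may be smaller than the length of
the input, so the input cannot be converted to the alphabet `S` beforehand, nor can the tape be
traversed at the end. Instead, the rest of the input stays a string over `Δ`, whose letters are
fetched one at a time when the head gets there; it is a suffix of the output as it stands. At the
end only the two visited parts are moved onto it, symbols outside `Δ` being dropped. Each step of
the machine lengthens the visited tape by at most one symbol, so the number of instructions is
linear in the number of steps (`TuringMachine.exec_of_evolves`).

The term that runs a program is the code of an instruction applied to a dispatcher and to the
encodings of the three stacks. The dispatcher selects the code at a given label, and it is passed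
along as an argument, which gives recursion. An encoded string is its own case distinction, so a
`pop` is the application of a stack to the branches for the letters and for the empty string
(`Term.reducesWithin_encode_cons`, `Term.reducesWithin_encode_nil`). For closed `V`, the step from
`(λx.M)V` costs at most `1` if `x` occurs at most once in `M`, whatever the length of `V`
(`Term.reducesWithin_beta`). All stacks are used linearly in this sense, and only the dispatcher,
whose length is a constant, is copied. Hence each instruction has constant cost
(`Term.reducesWithin_of_exec`).

All substituted terms are closed, so shifting does not affect them.
-/

namespace LambdaCost

namespace Term

/-! ### Closed terms, occurrences and substitution -/

/-- All free variables of the term have an index below the given bound. -/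
def ClosedAt : ℕ → Term → Prop
  | k, var i => i < k
  | k, lam M => ClosedAt (k + 1) M
  | k, app M N => ClosedAt k M ∧ ClosedAt k N

/-- The number of occurrences of the variable with index `k`. -/
def occ : ℕ → Term → ℕ
  | k, var i => if i = k then 1 else 0
  | k, lam M => occ (k + 1) M
  | k, app M N => occ k M + occ k N

/-- Closed values: the only terms that the simulation ever substitutes. -/
def IsClosedValue (V : Term) : Prop := IsValue V ∧ ClosedAt 0 V

theorem ClosedAt.mono {M : Term} {j k : ℕ} (h : ClosedAt j M) (hjk : j ≤ k) : ClosedAt k M := by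
  induction M generalizing j k with
  | var i => exact lt_of_lt_of_le (show i < j from h) hjk
  | lam M ih => exact ih (j := j + 1) h (by omega)
  | app M N ihM ihN => exact ⟨ihM h.1 hjk, ihN h.2 hjk⟩

theorem ClosedAt.shift_eq {M : Term} {c : ℕ} (h : ClosedAt c M) : shift c M = M := by
  induction M generalizing c with
  | var i => simp [shift, show i < c from h]
  | lam M ih => rw [shift, ih h]
  | app M N ihM ihN => rw [shift, ihM h.1, ihN h.2]

theorem ClosedAt.subst_eq {M : Term} {k : ℕ} (h : ClosedAt k M) (V : Term) : subst k V M = M := by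
  induction M generalizing k V with
  | var i => simp [subst, show i < k from h]
  | lam M ih => rw [subst, ih h]
  | app M N ihM ihN => rw [subst, ihM h.1, ihN h.2]

theorem ClosedAt.occ_eq_zero {M : Term} {k : ℕ} (h : ClosedAt k M) : occ k M = 0 := by
  induction M generalizing k with
  | var i => simp [occ, (show i < k from h).ne]
  | lam M ih => rw [occ, ih h]
  | app M N ihM ihN => rw [occ, ihM h.1, ihN h.2]

theorem size_subst {V : Term} (hV : ClosedAt 0 V) (k : ℕ) (M : Term) :
    size (subst k V M) + occ k M = size M + occ k M * size V := by
  induction M generalizing k with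
  | var i =>
    rcases lt_trichotomy i k with h | h | h
    · simp [subst, occ, size, h, h.ne]
    · simp [subst, occ, size, h]; omega
    · simp [subst, occ, size, h.not_gt, h.ne']
  | lam M ih =>
    have := ih (k + 1)
    simp only [subst, occ, size, hV.shift_eq]; omega
  | app M N ihM ihN =>
    have := ihM k
    have := ihN k
    simp only [subst, occ, size, add_mul]; omega

theorem occ_subst {V : Term} (hV : ClosedAt 0 V) {j k : ℕ} (hjk : j < k) (M : Term) :
    occ j (subst k V M) = occ j M := by
  induction M generalizing j k with
  | var i =>
    rcases lt_trichotomy i k with h | h | h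
    · simp [subst, h]
    · subst h
      simp [subst, occ, hjk.ne', (hV.mono (Nat.zero_le j)).occ_eq_zero]
    · simp only [subst, h.not_gt, h.ne', occ, if_false]
      rw [if_neg (by omega), if_neg (by omega)]
  | lam M ih => simp only [subst, occ, hV.shift_eq]; exact ih (by omega)
  | app M N ihM ihN => simp only [subst, occ, ihM hjk, ihN hjk]

theorem closedAt_iterate_lam (n k : ℕ) (M : Term) :
    ClosedAt k (lam^[n] M) ↔ ClosedAt (k + n) M := by
  induction n generalizing k with
  | zero => rfl
  | succ n ih => rw [Function.iterate_succ_apply', ClosedAt, ih]; congr! 1; omega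

theorem occ_iterate_lam (n k : ℕ) (M : Term) : occ k (lam^[n] M) = occ (k + n) M := by
  induction n generalizing k with
  | zero => rfl
  | succ n ih => rw [Function.iterate_succ_apply', occ, ih]; congr 1; omega

theorem subst_iterate_lam {V : Term} (hV : ClosedAt 0 V) (n k : ℕ) (M : Term) :
    subst k V (lam^[n] M) = lam^[n] (subst (k + n) V M) := by
  induction n generalizing k with
  | zero => rfl
  | succ n ih =>
    rw [Function.iterate_succ_apply', subst, hV.shift_eq, ih, Function.iterate_succ_apply']
    congr 3; omega

theorem isValue_iterate_lam (n : ℕ) (M : Term) : IsValue (lam^[n + 1] M) := by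
  rw [Function.iterate_succ_apply']; exact .lam _

/-! ### Reduction within a cost bound -/

/-- `M` reduces to `N` with total difference cost at most `c`. -/
def ReducesWithin (c : ℕ) (M N : Term) : Prop := ∃ α, WRed M α N ∧ α.sum ≤ c

theorem ReducesWithin.refl (c : ℕ) (M : Term) : ReducesWithin c M M := ⟨[], .refl M, by simp⟩

theorem ReducesWithin.mono {c d : ℕ} {M N : Term} (h : ReducesWithin c M N) (hcd : c ≤ d) :
    ReducesWithin d M N :=
  let ⟨α, hα, hc⟩ := h; ⟨α, hα, hc.trans hcd⟩

theorem ReducesWithin.trans {c d : ℕ} {M N L : Term} (h : ReducesWithin c M N)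
    (h' : ReducesWithin d N L) : ReducesWithin (c + d) M L := by
  obtain ⟨α, hα, hc⟩ := h
  obtain ⟨β, hβ, hd⟩ := h'
  exact ⟨α ++ β, hα.trans hβ, by simp; omega⟩

theorem WRed.appLeft {M M' : Term} {α : List ℕ} (h : WRed M α M') (N : Term) :
    WRed (app M N) α (app M' N) := by
  induction h with
  | refl M => exact .refl _
  | @single M M' h =>
    have := WRed.single (Red.appLeft (N := N) h)
    have hs : size (app M' N) - size (app M N) = size M' - size M := by simp only [size]; omega
    rwa [hs] at this
  | trans _ _ ih ih' => exact ih.trans ih'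

/-- The application of a term to a list of arguments, from left to right. -/
def applyAll (M : Term) (Ns : List Term) : Term := Ns.foldl app M

theorem applyAll_append (M : Term) (Ns Ns' : List Term) :
    applyAll M (Ns ++ Ns') = applyAll (applyAll M Ns) Ns' := List.foldl_append

theorem ReducesWithin.applyAll {c : ℕ} {M M' : Term} (h : ReducesWithin c M M') (Ns : List Term) :
    ReducesWithin c (applyAll M Ns) (applyAll M' Ns) := by
  induction Ns generalizing M M' with
  | nil => exact h
  | cons N Ns ih => obtain ⟨α, hα, hc⟩ := h; exact ih ⟨α, hα.appLeft N, hc⟩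

theorem closedAt_applyAll (k : ℕ) (M : Term) (Ns : List Term) :
    ClosedAt k (applyAll M Ns) ↔ ClosedAt k M ∧ ∀ N ∈ Ns, ClosedAt k N := by
  induction Ns generalizing M with
  | nil => simp [applyAll]
  | cons N Ns ih => exact (ih (app M N)).trans (by simp [ClosedAt, and_assoc])

theorem occ_applyAll (k : ℕ) (M : Term) (Ns : List Term) :
    occ k (applyAll M Ns) = occ k M + (Ns.map (occ k)).sum := by
  induction Ns generalizing M with
  | nil => simp [applyAll]
  | cons N Ns ih => exact (ih (app M N)).trans (by simp [occ, add_assoc])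

/-- A beta step costs at most `1` if the variable occurs at most once, however large the argument:
the redex itself contributes an abstraction, an application and the argument. -/
theorem reducesWithin_beta {V : Term} (hV : IsClosedValue V) (M : Term) :
    ReducesWithin (1 + (occ 0 M - 1) * size V) (app (lam M) V) (subst 0 V M) := by
  refine ⟨_, .single (.beta hV.1), ?_⟩
  have h := size_subst hV.2 0 M
  rcases ho : occ 0 M with _ | m
  · simp only [ho, size, List.sum_singleton] at h ⊢; omega
  · simp only [ho, size, List.sum_singleton, Nat.add_sub_cancel, add_mul] at h ⊢; omega

/-- Successive substitution of closed terms for the variables bound by `Vs.length` leading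
abstractions; the outermost one comes first. -/
def substs : Term → List Term → Term
  | M, [] => M
  | M, V :: Vs => substs (subst Vs.length V M) Vs

/-- A bound for the cost of supplying the arguments `Vs` to `Vs.length` abstractions over `M`. -/
def betaCost (M : Term) : List Term → ℕ
  | [] => 0
  | V :: Vs => 1 + (occ Vs.length M - 1) * size V + betaCost M Vs

theorem betaCost_congr {M N : Term} {Vs : List Term} (h : ∀ i < Vs.length, occ i M = occ i N) :
    betaCost M Vs = betaCost N Vs := by
  induction Vs with
  | nil => rfl
  | cons V Vs ih =>
    rw [betaCost, betaCost, h _ (by simp), ih fun i hi => h i (by simp; omega)]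

theorem betaCost_eq_length {M : Term} (h : ∀ i, occ i M ≤ 1) (Vs : List Term) :
    betaCost M Vs = Vs.length := by
  induction Vs with
  | nil => rfl
  | cons V Vs ih =>
    rw [betaCost, Nat.sub_eq_zero_of_le (h _), ih, List.length_cons]; omega

theorem reducesWithin_substs {Vs : List Term} (hVs : ∀ V ∈ Vs, IsClosedValue V) (M : Term) :
    ReducesWithin (betaCost M Vs) (applyAll (lam^[Vs.length] M) Vs) (substs M Vs) := by
  induction Vs generalizing M with
  | nil => exact .refl _ _
  | cons V Vs ih =>
    have hV := hVs V (by simp)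
    have h := (reducesWithin_beta hV (lam^[Vs.length] M)).applyAll Vs
    rw [subst_iterate_lam hV.2, occ_iterate_lam, zero_add] at h
    have h' := h.trans (ih (fun W hW => hVs W (by simp [hW])) (subst Vs.length V M))
    rw [betaCost_congr fun i hi => occ_subst hV.2 hi M] at h'
    rwa [List.length_cons, Function.iterate_succ_apply']

theorem substs_app (M N : Term) (Vs : List Term) :
    substs (app M N) Vs = app (substs M Vs) (substs N Vs) := by
  induction Vs generalizing M N with
  | nil => rfl
  | cons V Vs ih => exact ih _ _

theorem substs_applyAll (M : Term) (Ns Vs : List Term) :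
    substs (applyAll M Ns) Vs = applyAll (substs M Vs) (Ns.map (substs · Vs)) := by
  induction Ns generalizing M with
  | nil => rfl
  | cons N Ns ih => exact (ih (app M N)).trans (by rw [substs_app]; rfl)

theorem ClosedAt.substs_eq {M : Term} (h : ClosedAt 0 M) (Vs : List Term) : substs M Vs = M := by
  induction Vs with
  | nil => rfl
  | cons V Vs ih => rw [substs, (h.mono (Nat.zero_le _)).subst_eq, ih]

theorem substs_var {Vs : List Term} (hVs : ∀ V ∈ Vs, IsClosedValue V) {j : ℕ}
    (hj : j < Vs.length) : substs (var j) Vs = Vs[Vs.length - 1 - j] := by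
  induction Vs with
  | nil => simp at hj
  | cons V Vs ih =>
    have ih := ih fun W hW => hVs W (by simp [hW])
    rw [List.length_cons] at hj
    rcases Nat.lt_succ_iff_lt_or_eq.mp hj with h | h
    · simp only [substs, subst, h, if_true, ih h, List.length_cons]
      rw [List.getElem_cons, dif_neg (by omega)]
      congr 1; omega
    · subst h
      simp [substs, subst, (hVs V (by simp)).2.substs_eq]

/-! ### Scott encodings and case distinction -/

section Scott

variable {A : Type*} {n : ℕ} (e : A ≃ Fin n)

theorem isClosedValue_encode (u : List A) : IsClosedValue (encode e u) := by
  induction u with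
  | nil =>
    refine ⟨isValue_iterate_lam _ _, ?_⟩
    rw [encode, closedAt_iterate_lam, ClosedAt]
    omega
  | cons a u ih =>
    refine ⟨isValue_iterate_lam _ _, ?_⟩
    rw [encode, closedAt_iterate_lam]
    exact ⟨by simp only [ClosedAt]; omega, ih.2.mono (Nat.zero_le _)⟩

/-- The arguments of an encoded string in a case distinction: a branch for each letter, and one for
the empty string. -/
def branches (B : A → Term) (E : Term) : List Term := List.ofFn (fun i => B (e.symm i)) ++ [E]

theorem forall_mem_branches {B : A → Term} {E : Term} {p : Term → Prop} (hB : ∀ a, p (B a))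
    (hE : p E) : ∀ V ∈ branches e B E, p V := by
  simp only [branches, List.mem_append, List.mem_ofFn, List.mem_singleton]
  rintro V (⟨i, rfl⟩ | rfl)
  exacts [hB _, hE]

theorem length_branches (B : A → Term) (E : Term) : (branches e B E).length = n + 1 := by
  simp [branches]

theorem reducesWithin_encode_nil {B : A → Term} {E : Term} (hB : ∀ a, IsClosedValue (B a))
    (hE : IsClosedValue E) :
    ReducesWithin (n + 1) (applyAll (encode e []) (branches e B E)) E := by
  have h := reducesWithin_substs (forall_mem_branches e hB hE) (var 0)
  rw [substs_var (forall_mem_branches e hB hE) (by simp [length_branches]),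
    betaCost_eq_length (fun i => by unfold occ; split <;> simp)] at h
  simp only [length_branches] at h
  have hget : (branches e B E)[n + 1 - 1 - 0]'(by simp [length_branches]) = E := by
    simp [branches]
  rwa [hget] at h

theorem reducesWithin_encode_cons {B : A → Term} {E : Term} (hB : ∀ a, IsClosedValue (B a))
    (hE : IsClosedValue E) (a : A) (u : List A) :
    ReducesWithin (n + 1) (applyAll (encode e (a :: u)) (branches e B E))
      (app (B a) (encode e u)) := by
  have hu := (isClosedValue_encode e u).2
  have h := reducesWithin_substs (forall_mem_branches e hB hE)
    (app (var (n - (e a : ℕ))) (encode e u))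
  rw [substs_app, hu.substs_eq, substs_var (forall_mem_branches e hB hE)
      (by rw [length_branches]; omega), betaCost_eq_length] at h
  · simp only [length_branches] at h
    have hget : (branches e B E)[n + 1 - 1 - (n - (e a : ℕ))]'(by
        rw [length_branches]; omega) = B a := by
      have : n - (n - (e a : ℕ)) = e a := by omega
      simp [branches, this]
    rwa [hget] at h
  · intro i
    rw [occ, (hu.mono (Nat.zero_le i)).occ_eq_zero]
    unfold occ; split <;> simp

/-- The encoding of the string `a x`, where `x` is the variable with index `i`; this index is raised
below the abstractions of the encoding. -/
def consVar (a : A) (i : ℕ) : Term := lam^[n + 1] (app (var (n - (e a : ℕ))) (var (i + (n + 1))))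

theorem occ_consVar (a : A) (i k : ℕ) : occ k (consVar e a i) = occ k (var i) := by
  rw [consVar, occ_iterate_lam, occ, occ, occ, occ, if_neg (by omega)]
  simp

theorem closedAt_consVar (a : A) {i k : ℕ} (h : i < k) : ClosedAt k (consVar e a i) := by
  rw [consVar, closedAt_iterate_lam]
  exact ⟨by simp only [ClosedAt]; omega, by simp only [ClosedAt]; omega⟩

theorem substs_consVar {Vs : List Term} (hVs : ∀ V ∈ Vs, IsClosedValue V) (a : A) {i : ℕ}
    {u : List A} (hi : i < Vs.length) (hu : substs (var i) Vs = encode e u) :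
    substs (consVar e a i) Vs = encode e (a :: u) := by
  induction Vs with
  | nil => simp at hi
  | cons V Vs ih =>
    have hV := hVs V (by simp)
    have ih := ih fun W hW => hVs W (by simp [hW])
    rw [List.length_cons] at hi
    rw [substs, subst] at hu
    rw [substs, consVar, subst_iterate_lam hV.2, subst, subst, if_pos (by omega), subst]
    rcases Nat.lt_succ_iff_lt_or_eq.mp hi with h | h
    · rw [if_pos h] at hu
      rw [if_pos (by omega)]
      exact ih h hu
    · rw [if_neg (by omega), if_pos h, hV.2.substs_eq] at hu
      rw [if_neg (by omega), if_pos (by omega), hu]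
      exact (isClosedValue_encode e (a :: u)).2.substs_eq _

end Scott

end Term

/-! ### Programs on three stacks -/

/-- Instructions of programs on three stacks with alphabets `A`, `B`, `C` and labels in `I`. A `pop`
continues at the label given for the removed letter, or at its last argument if the stack is
empty. -/
inductive Instr (I A B C : Type*)
  | push₁ (a : A) (i : I)
  | push₂ (b : B) (i : I)
  | push₃ (c : C) (i : I)
  | pop₁ (f : A → I) (i : I)
  | pop₂ (f : B → I) (i : I)
  | pop₃ (f : C → I) (i : I)
  | halt

open Instr in
/-- `Exec P k i l r u w`: started at the label `i` with stacks `l`, `r`, `u`, the program `P` halts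
after `k` instructions with `w` on the third stack. -/
inductive Exec {I A B C : Type*} (P : I → Instr I A B C) :
    ℕ → I → List A → List B → List C → List C → Prop
  | halt {i l r u} : P i = halt → Exec P 0 i l r u u
  | push₁ {k i j l r u w a} : P i = push₁ a j → Exec P k j (a :: l) r u w →
      Exec P (k + 1) i l r u w
  | push₂ {k i j l r u w b} : P i = push₂ b j → Exec P k j l (b :: r) u w →
      Exec P (k + 1) i l r u w
  | push₃ {k i j l r u w c} : P i = push₃ c j → Exec P k j l r (c :: u) w →
      Exec P (k + 1) i l r u w
  | pop₁Nil {k i f j r u w} : P i = pop₁ f j → Exec P k j [] r u w → Exec P (k + 1) i [] r u w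
  | pop₁Cons {k i f j a l r u w} : P i = pop₁ f j → Exec P k (f a) l r u w →
      Exec P (k + 1) i (a :: l) r u w
  | pop₂Nil {k i f j l u w} : P i = pop₂ f j → Exec P k j l [] u w → Exec P (k + 1) i l [] u w
  | pop₂Cons {k i f j l b r u w} : P i = pop₂ f j → Exec P k (f b) l r u w →
      Exec P (k + 1) i l (b :: r) u w
  | pop₃Nil {k i f j l r w} : P i = pop₃ f j → Exec P k j l r [] w → Exec P (k + 1) i l r [] w
  | pop₃Cons {k i f j l r c u w} : P i = pop₃ f j → Exec P k (f c) l r u w →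
      Exec P (k + 1) i l r (c :: u) w

/-! ### Compilation of stack programs to lambda terms -/

namespace Term

section Compile

variable {I A B C : Type*} {m a b c : ℕ} (eI : I ≃ Fin m) (eA : A ≃ Fin a) (eB : B ≃ Fin b)
  (eC : C ≃ Fin c)

/-- The continuation at the label `i` with stacks `t₁`, `t₂`, `t₃`, where the variable with index
`3` stands for the dispatcher of the program. -/
def jump (i : I) (t₁ t₂ t₃ : Term) : Term :=
  applyAll (var 3) [encode eI [i], var 3, t₁, t₂, t₃]

/-- The code of an instruction. It takes a dummy argument (what is left of the label after its
selection), the dispatcher and the three stacks, which have the indices `4`, `3`, `2`, `1` and `0`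
in its body. In the code of a `pop`, the remaining data are passed to the selected branch as
arguments, so that the branches are closed and each stack occurs at most once. The branch for a
letter takes the rest of the popped stack as its first argument, with index `4`, and ignores what it
is given in the place of the popped stack. -/
def code : Instr I A B C → Term
  | .push₁ x i => lam^[5] (jump eI i (consVar eA x 2) (var 1) (var 0))
  | .push₂ x i => lam^[5] (jump eI i (var 2) (consVar eB x 1) (var 0))
  | .push₃ x i => lam^[5] (jump eI i (var 2) (var 1) (consVar eC x 0))
  | .pop₁ f i => lam^[5] (applyAll (var 2)
      (branches eA (fun x => lam^[5] (jump eI (f x) (var 4) (var 1) (var 0)))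
        (lam^[4] (jump eI i (var 2) (var 1) (var 0))) ++
      [var 3, encode eA [], var 1, var 0]))
  | .pop₂ f i => lam^[5] (applyAll (var 1)
      (branches eB (fun x => lam^[5] (jump eI (f x) (var 2) (var 4) (var 0)))
        (lam^[4] (jump eI i (var 2) (var 1) (var 0))) ++
      [var 3, var 2, encode eB [], var 0]))
  | .pop₃ f i => lam^[5] (applyAll (var 0)
      (branches eC (fun x => lam^[5] (jump eI (f x) (var 2) (var 1) (var 4)))
        (lam^[4] (jump eI i (var 2) (var 1) (var 0))) ++
      [var 3, var 2, var 1, encode eC []]))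
  | .halt => lam^[5] (var 0)

theorem isClosedValue_iterate_lam {n : ℕ} {M : Term} (h : ClosedAt (n + 1) M) :
    IsClosedValue (lam^[n + 1] M) :=
  ⟨isValue_iterate_lam _ _, by rwa [closedAt_iterate_lam, zero_add]⟩

theorem closedAt_jump {k : ℕ} {i : I} {t₁ t₂ t₃ : Term} (hk : 3 < k) (h₁ : ClosedAt k t₁)
    (h₂ : ClosedAt k t₂) (h₃ : ClosedAt k t₃) : ClosedAt k (jump eI i t₁ t₂ t₃) := by
  rw [jump, closedAt_applyAll]
  simp [ClosedAt, hk, h₁, h₂, h₃, (isClosedValue_encode eI [i]).2.mono (Nat.zero_le k)]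

theorem isClosedValue_lam_jump {n : ℕ} (hn : 3 ≤ n) {i : I} {t₁ t₂ t₃ : Term}
    (h₁ : ClosedAt (n + 1) t₁) (h₂ : ClosedAt (n + 1) t₂) (h₃ : ClosedAt (n + 1) t₃) :
    IsClosedValue (lam^[n + 1] (jump eI i t₁ t₂ t₃)) :=
  isClosedValue_iterate_lam (closedAt_jump eI (by omega) h₁ h₂ h₃)

theorem isClosedValue_lam_pop {D : Type*} {d : ℕ} (e : D ≃ Fin d) {n i : ℕ} {F : D → Term}
    {E : Term} {Ns : List Term} (hi : i < n + 1) (hF : ∀ x, IsClosedValue (F x))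
    (hE : IsClosedValue E) (hNs : ∀ N ∈ Ns, ClosedAt (n + 1) N) :
    IsClosedValue (lam^[n + 1] (applyAll (var i) (branches e F E ++ Ns))) := by
  refine isClosedValue_iterate_lam ?_
  rw [closedAt_applyAll]
  refine ⟨hi, fun N hN => ?_⟩
  rcases List.mem_append.mp hN with h | h
  · exact (forall_mem_branches e hF hE N h).2.mono (Nat.zero_le _)
  · exact hNs N h

theorem isClosedValue_code (x : Instr I A B C) : IsClosedValue (code eI eA eB eC x) := by
  have h₁ := (isClosedValue_encode eA []).2.mono (Nat.zero_le 5)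
  have h₂ := (isClosedValue_encode eB []).2.mono (Nat.zero_le 5)
  have h₃ := (isClosedValue_encode eC []).2.mono (Nat.zero_le 5)
  cases x with
  | push₁ x i =>
    exact isClosedValue_lam_jump eI (by decide) (closedAt_consVar _ _ (by decide))
      (by simp [ClosedAt]) (by simp [ClosedAt])
  | push₂ x i =>
    exact isClosedValue_lam_jump eI (by decide) (by simp [ClosedAt])
      (closedAt_consVar _ _ (by decide)) (by simp [ClosedAt])
  | push₃ x i =>
    exact isClosedValue_lam_jump eI (by decide) (by simp [ClosedAt]) (by simp [ClosedAt])
      (closedAt_consVar _ _ (by decide))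
  | pop₁ f i | pop₂ f i | pop₃ f i =>
    refine isClosedValue_lam_pop _ (by decide) (fun x => isClosedValue_lam_jump eI (by decide)
      ?_ ?_ ?_) (isClosedValue_lam_jump eI (by decide) ?_ ?_ ?_) ?_ <;>
    simp [ClosedAt, h₁, h₂, h₃]
  | halt => exact isClosedValue_iterate_lam (by simp [ClosedAt])

variable (P : I → Instr I A B C)

/-- The dispatcher of a program: applied to the encoding of a label as a one-letter string, it
yields the code of the instruction at this label (applied to the encoding of `ε`). The branch for
the empty string is never taken. Recursion is by passing the dispatcher to the code of the
instructions, so no fixed-point combinator is needed. -/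
def dispatcher : Term :=
  lam (applyAll (var 0) (branches eI (fun i => code eI eA eB eC (P i)) (lam (var 0))))

/-- The term that runs a program from the label `i` with stacks `l`, `r` and `u`. -/
def runTerm (i : I) (l : List A) (r : List B) (u : List C) : Term :=
  applyAll (code eI eA eB eC (P i))
    [encode eI [], dispatcher eI eA eB eC P, encode eA l, encode eB r, encode eC u]

theorem isClosedValue_dispatcher : IsClosedValue (dispatcher eI eA eB eC P) := by
  have := isClosedValue_lam_pop eI (n := 0) (i := 0) (Ns := []) (by decide)
    (fun i => isClosedValue_code eI eA eB eC (P i))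
    (isClosedValue_iterate_lam (n := 0) (M := var 0) (by simp [ClosedAt])) (by simp)
  rwa [List.append_nil] at this

/-- The first step passes the label to the dispatcher, the others select the code. -/
theorem reducesWithin_dispatcher (i : I) :
    ReducesWithin (m + 2) (app (dispatcher eI eA eB eC P) (encode eI [i]))
      (app (code eI eA eB eC (P i)) (encode eI [])) := by
  have hB := fun i => isClosedValue_code eI eA eB eC (P i)
  have hE : IsClosedValue (lam (var 0)) :=
    isClosedValue_iterate_lam (n := 0) (M := var 0) (by simp [ClosedAt])
  have hmem := forall_mem_branches eI hB hE
  have h := reducesWithin_substs (Vs := [encode eI [i]])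
    (by simpa using isClosedValue_encode eI [i])
    (applyAll (var 0) (branches eI (fun i => code eI eA eB eC (P i)) (lam (var 0))))
  rw [substs_applyAll, List.map_congr_left (g := id) fun N hN => (hmem N hN).2.substs_eq _,
    List.map_id, betaCost_eq_length] at h
  · refine (h.trans (reducesWithin_encode_cons eI hB hE i [])).mono ?_
    simp; omega
  · intro k
    rw [occ_applyAll, List.map_congr_left (g := fun _ => 0) fun N hN =>
      ((hmem N hN).2.mono (Nat.zero_le _)).occ_eq_zero]
    unfold occ; split <;> simp

/-- Only the variable of the dispatcher occurs twice. -/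
theorem betaCost_le {M : Term} (h : ∀ k, occ k M ≤ if k = 3 then 2 else 1)
    (Ws : List Term) (Z X₁ X₂ X₃ : Term) :
    betaCost M (Ws ++ [Z, X₁, X₂, X₃]) ≤ Ws.length + 4 + size Z := by
  induction Ws with
  | nil =>
    have h₀ := h 0
    have h₁ := h 1
    have h₂ := h 2
    have h₃ : (occ 3 M - 1) * size Z ≤ 1 * size Z :=
      Nat.mul_le_mul_right _ (by have := h 3; simp at this; omega)
    simp only [OfNat.zero_ne_ofNat, OfNat.one_ne_ofNat, Nat.reduceEqDiff, if_false] at h₀ h₁ h₂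
    simp only [List.nil_append, betaCost, List.length_cons, List.length_nil, Nat.reduceAdd,
      Nat.sub_eq_zero_of_le h₀, Nat.sub_eq_zero_of_le h₁, Nat.sub_eq_zero_of_le h₂]
    omega
  | cons W Ws ih =>
    have hk := h (Ws.length + 4)
    rw [if_neg (by omega)] at hk
    simp only [List.cons_append, betaCost, List.length_append, List.length_cons, List.length_nil,
      Nat.reduceAdd, Nat.zero_add, Nat.sub_eq_zero_of_le hk]
    omega

variable {eI eA eB eC P}

/-- Code or a branch that ends in a jump reduces, at a cost that does not depend on the stacks, to
the term that runs the program from the label of the jump. The list `Ws` holds the argument that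
precedes the dispatcher, if there is one. -/
theorem reducesWithin_jump {Ws : List Term} (hWs : ∀ W ∈ Ws, IsClosedValue W)
    {l l' : List A} {r r' : List B} {u u' : List C} {t₁ t₂ t₃ : Term} (i : I)
    {Vs : List Term}
    (hV : Vs = Ws ++ [dispatcher eI eA eB eC P, encode eA l, encode eB r, encode eC u])
    (ho : ∀ k, occ k t₁ + occ k t₂ + occ k t₃ ≤ if k = 3 then 0 else 1)
    (h₁ : substs t₁ Vs = encode eA l') (h₂ : substs t₂ Vs = encode eB r')
    (h₃ : substs t₃ Vs = encode eC u') :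
    ReducesWithin (Ws.length + size (dispatcher eI eA eB eC P) + m + 6)
      (applyAll (lam^[Ws.length + 4] (jump eI i t₁ t₂ t₃)) Vs)
      (runTerm eI eA eB eC P i l' r' u') := by
  have hc : ∀ V ∈ Vs, IsClosedValue V := by
    subst hV
    simp only [List.forall_mem_append, List.forall_mem_cons]
    exact ⟨hWs, isClosedValue_dispatcher .., isClosedValue_encode .., isClosedValue_encode ..,
      isClosedValue_encode .., by simp⟩
  have hlen : Vs.length = Ws.length + 4 := by simp [hV]
  have h := reducesWithin_substs hc (jump eI i t₁ t₂ t₃)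
  have hZ : substs (var 3) Vs = dispatcher eI eA eB eC P := by
    rw [substs_var hc (by omega)]
    simp [hV]
  have hcost : betaCost (jump eI i t₁ t₂ t₃) Vs ≤
      Ws.length + 4 + size (dispatcher eI eA eB eC P) := by
    rw [hV]
    refine betaCost_le (fun k => ?_) _ _ _ _ _
    have := ho k
    rw [jump, occ_applyAll]
    simp only [List.map_cons, List.map_nil, List.sum_cons, List.sum_nil, occ,
      ((isClosedValue_encode eI [i]).2.mono (Nat.zero_le k)).occ_eq_zero]
    split_ifs at this ⊢ <;> omega
  have hs : substs (jump eI i t₁ t₂ t₃) Vs = applyAll (app (dispatcher eI eA eB eC P)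
      (encode eI [i])) [dispatcher eI eA eB eC P, encode eA l', encode eB r', encode eC u'] := by
    rw [jump, substs_applyAll, hZ]
    simp only [List.map_cons, List.map_nil, hZ, h₁, h₂, h₃,
      (isClosedValue_encode eI [i]).2.substs_eq]
    rfl
  rw [hs, hlen] at h
  exact (h.trans ((reducesWithin_dispatcher eI eA eB eC P i).applyAll _)).mono (by omega)

end Compile

/-! ### The cost of running the compiled program -/

section Run

variable {I A B C : Type*} {m a b c : ℕ} {eI : I ≃ Fin m} {eA : A ≃ Fin a} {eB : B ≃ Fin b}
  {eC : C ≃ Fin c} {P : I → Instr I A B C}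

/-- The part common to both outcomes of a case distinction: the arguments are substituted, and the
string meets its branches. The closed branches are not affected by the substitution, and nothing
else is copied. -/
theorem reducesWithin_case {D : Type*} {d : ℕ} (e : D ≃ Fin d) {Vs Ns : List Term} {j : ℕ}
    {F : D → Term} {E : Term} {s : List D} (hV : ∀ V ∈ Vs, IsClosedValue V)
    (hF : ∀ x, IsClosedValue (F x)) (hE : IsClosedValue E)
    (ho : ∀ k, occ k (var j) + (Ns.map (occ k)).sum ≤ 1) (hj : substs (var j) Vs = encode e s) :
    ReducesWithin Vs.length
      (applyAll (lam^[Vs.length] (applyAll (var j) (branches e F E ++ Ns))) Vs)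
      (applyAll (applyAll (encode e s) (branches e F E)) (Ns.map (substs · Vs))) := by
  have hmem := forall_mem_branches e hF hE
  have h := reducesWithin_substs hV (applyAll (var j) (branches e F E ++ Ns))
  rw [betaCost_eq_length] at h
  · rwa [substs_applyAll, hj, List.map_append, List.map_congr_left (l := branches e F E) (g := id)
      fun N hN => (hmem N hN).2.substs_eq _, List.map_id, applyAll_append (encode e s)] at h
  · intro k
    rw [occ_applyAll, List.map_append, List.sum_append, List.map_congr_left
      (l := branches e F E) (g := fun _ => 0) fun N hN =>
      ((hmem N hN).2.mono (Nat.zero_le _)).occ_eq_zero]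
    simpa using ho k

theorem reducesWithin_case_nil {D : Type*} {d : ℕ} (e : D ≃ Fin d) {Vs Ns : List Term} {j : ℕ}
    {F : D → Term} {E : Term} (hV : ∀ V ∈ Vs, IsClosedValue V)
    (hF : ∀ x, IsClosedValue (F x)) (hE : IsClosedValue E)
    (ho : ∀ k, occ k (var j) + (Ns.map (occ k)).sum ≤ 1) (hj : substs (var j) Vs = encode e []) :
    ReducesWithin (Vs.length + (d + 1))
      (applyAll (lam^[Vs.length] (applyAll (var j) (branches e F E ++ Ns))) Vs)
      (applyAll E (Ns.map (substs · Vs))) :=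
  (reducesWithin_case e hV hF hE ho hj).trans ((reducesWithin_encode_nil e hF hE).applyAll _)

theorem reducesWithin_case_cons {D : Type*} {d : ℕ} (e : D ≃ Fin d) {Vs Ns : List Term} {j : ℕ}
    {F : D → Term} {E : Term} {x : D} {s : List D} (hV : ∀ V ∈ Vs, IsClosedValue V)
    (hF : ∀ x, IsClosedValue (F x)) (hE : IsClosedValue E)
    (ho : ∀ k, occ k (var j) + (Ns.map (occ k)).sum ≤ 1)
    (hj : substs (var j) Vs = encode e (x :: s)) :
    ReducesWithin (Vs.length + (d + 1))
      (applyAll (lam^[Vs.length] (applyAll (var j) (branches e F E ++ Ns))) Vs)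
      (applyAll (F x) (encode e s :: Ns.map (substs · Vs))) :=
  (reducesWithin_case e hV hF hE ho hj).trans
    ((reducesWithin_encode_cons e hF hE x s).applyAll _)

@[simp]
theorem occ_encode {D : Type*} {d : ℕ} (e : D ≃ Fin d) (k : ℕ) (s : List D) :
    occ k (encode e s) = 0 :=
  ((isClosedValue_encode e s).2.mono (Nat.zero_le k)).occ_eq_zero

@[simp]
theorem subst_encode {D : Type*} {d : ℕ} (e : D ≃ Fin d) (k : ℕ) (V : Term) (s : List D) :
    subst k V (encode e s) = encode e s :=
  ((isClosedValue_encode e s).2.mono (Nat.zero_le k)).subst_eq V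

@[simp]
theorem subst_dispatcher (k : ℕ) (V : Term) :
    subst k V (dispatcher eI eA eB eC P) = dispatcher eI eA eB eC P :=
  ((isClosedValue_dispatcher eI eA eB eC P).2.mono (Nat.zero_le k)).subst_eq V

variable (eI eA eB eC P) in
/-- A bound for the cost of simulating one instruction; it does not depend on the stacks, and the
summand `20` covers the constants of all instructions. -/
def stepCost : ℕ := size (dispatcher eI eA eB eC P) + m + a + b + c + 20

/-- The stack program `P` is simulated at constant cost per instruction. -/
theorem reducesWithin_of_exec {k : ℕ} {i : I} {l : List A} {r : List B} {u w : List C}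
    (h : Exec P k i l r u w) :
    ReducesWithin (stepCost eI eA eB eC P * (k + 1)) (runTerm eI eA eB eC P i l r u)
      (encode eC w) := by
  have hargs : ∀ (l : List A) (r : List B) (u : List C), ∀ V ∈ [encode eI [],
      dispatcher eI eA eB eC P, encode eA l, encode eB r, encode eC u], IsClosedValue V := by
    simp [isClosedValue_encode, isClosedValue_dispatcher]
  have hI : ∀ V ∈ [encode eI []], IsClosedValue V := by simp [isClosedValue_encode]
  have hW₁ (s : List A) : ∀ V ∈ [encode eA s], IsClosedValue V := by simp [isClosedValue_encode]
  have hW₂ (s : List B) : ∀ V ∈ [encode eB s], IsClosedValue V := by simp [isClosedValue_encode]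
  have hW₃ (s : List C) : ∀ V ∈ [encode eC s], IsClosedValue V := by simp [isClosedValue_encode]
  -- One instruction, followed by a run of the program from the next label.
  have step {k : ℕ} {d : ℕ} {M N L : Term} (h : ReducesWithin d M N)
      (hd : d ≤ stepCost eI eA eB eC P)
      (h' : ReducesWithin (stepCost eI eA eB eC P * (k + 1)) N L) :
      ReducesWithin (stepCost eI eA eB eC P * (k + 1 + 1)) M L :=
    (h.trans h').mono (by rw [mul_add _ (k + 1), mul_one]; omega)
  induction h with
  | @halt i l r u hP =>
    rw [runTerm, hP, code]
    have h := reducesWithin_substs (hargs l r u) (var 0)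
    rw [substs_var (hargs l r u) (by simp),
      betaCost_eq_length fun k => by unfold occ; split <;> simp] at h
    exact h.mono (by simp [stepCost])
  | @push₁ k i j l r u w x hP _ ih =>
    rw [runTerm, hP, code]
    refine step (reducesWithin_jump hI j rfl (fun k => ?_)
      (substs_consVar _ (hargs l r u) x ?_ ?_) ?_ ?_) ?_ ih
    · simp only [occ, occ_consVar]
      split_ifs <;> omega
    rotate_right
    · simp [stepCost]; omega
    all_goals simp [substs, subst]
  | @push₂ k i j l r u w x hP _ ih =>
    rw [runTerm, hP, code]
    refine step (reducesWithin_jump hI j rfl (fun k => ?_)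
      ?_ (substs_consVar _ (hargs l r u) x ?_ ?_) ?_) ?_ ih
    · simp only [occ, occ_consVar]
      split_ifs <;> omega
    rotate_right
    · simp [stepCost]; omega
    all_goals simp [substs, subst]
  | @push₃ k i j l r u w x hP _ ih =>
    rw [runTerm, hP, code]
    refine step (reducesWithin_jump hI j rfl (fun k => ?_)
      ?_ ?_ (substs_consVar _ (hargs l r u) x ?_ ?_)) ?_ ih
    · simp only [occ, occ_consVar]
      split_ifs <;> omega
    rotate_right
    · simp [stepCost]; omega
    all_goals simp [substs, subst]
  | @pop₁Nil k i f j r u w hP _ ih =>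
    rw [runTerm, hP, code]
    refine step ((reducesWithin_case_nil eA (hargs [] r u) (fun x => ?_) ?_
      (fun k => ?_) ?_).trans
      (reducesWithin_jump (Ws := []) (by simp) (l := []) (r := r) (u := u) j ?_
        (fun k => ?_) ?_ ?_ ?_)) ?_ ih
    · exact isClosedValue_lam_jump eI (by decide) (by simp [ClosedAt]) (by simp [ClosedAt])
        (by simp [ClosedAt])
    · exact isClosedValue_lam_jump eI (by decide) (by simp [ClosedAt]) (by simp [ClosedAt])
        (by simp [ClosedAt])
    · simp only [occ, occ_encode, List.map_cons, List.map_nil, List.sum_cons, List.sum_nil]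
      split_ifs <;> omega
    · simp [substs, subst]
    · simp [substs, subst]
    · simp only [occ]
      split_ifs <;> omega
    rotate_right
    · simp [stepCost]; omega
    all_goals simp [substs, subst]
  | @pop₁Cons k i f j x l r u w hP _ ih =>
    rw [runTerm, hP, code]
    refine step ((reducesWithin_case_cons eA (s := l) (hargs (x :: l) r u) (fun x => ?_) ?_
      (fun k => ?_) ?_).trans
      (reducesWithin_jump (hW₁ l) (l := []) (r := r) (u := u) (f x) ?_
        (fun k => ?_) ?_ ?_ ?_)) ?_ ih
    · exact isClosedValue_lam_jump eI (by decide) (by simp [ClosedAt]) (by simp [ClosedAt])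
        (by simp [ClosedAt])
    · exact isClosedValue_lam_jump eI (by decide) (by simp [ClosedAt]) (by simp [ClosedAt])
        (by simp [ClosedAt])
    · simp only [occ, occ_encode, List.map_cons, List.map_nil, List.sum_cons, List.sum_nil]
      split_ifs <;> omega
    · simp [substs, subst]
    · simp [substs, subst]
    · simp only [occ]
      split_ifs <;> omega
    rotate_right
    · simp [stepCost]; omega
    all_goals simp [substs, subst]
  | @pop₂Nil k i f j l u w hP _ ih =>
    rw [runTerm, hP, code]
    refine step ((reducesWithin_case_nil eB (hargs l [] u) (fun x => ?_) ?_
      (fun k => ?_) ?_).trans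
      (reducesWithin_jump (Ws := []) (by simp) (l := l) (r := []) (u := u) j ?_
        (fun k => ?_) ?_ ?_ ?_)) ?_ ih
    · exact isClosedValue_lam_jump eI (by decide) (by simp [ClosedAt]) (by simp [ClosedAt])
        (by simp [ClosedAt])
    · exact isClosedValue_lam_jump eI (by decide) (by simp [ClosedAt]) (by simp [ClosedAt])
        (by simp [ClosedAt])
    · simp only [occ, occ_encode, List.map_cons, List.map_nil, List.sum_cons, List.sum_nil]
      split_ifs <;> omega
    · simp [substs, subst]
    · simp [substs, subst]
    · simp only [occ]
      split_ifs <;> omega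
    rotate_right
    · simp [stepCost]; omega
    all_goals simp [substs, subst]
  | @pop₂Cons k i f j l x r u w hP _ ih =>
    rw [runTerm, hP, code]
    refine step ((reducesWithin_case_cons eB (s := r) (hargs l (x :: r) u) (fun x => ?_) ?_
      (fun k => ?_) ?_).trans
      (reducesWithin_jump (hW₂ r) (l := l) (r := []) (u := u) (f x) ?_
        (fun k => ?_) ?_ ?_ ?_)) ?_ ih
    · exact isClosedValue_lam_jump eI (by decide) (by simp [ClosedAt]) (by simp [ClosedAt])
        (by simp [ClosedAt])
    · exact isClosedValue_lam_jump eI (by decide) (by simp [ClosedAt]) (by simp [ClosedAt])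
        (by simp [ClosedAt])
    · simp only [occ, occ_encode, List.map_cons, List.map_nil, List.sum_cons, List.sum_nil]
      split_ifs <;> omega
    · simp [substs, subst]
    · simp [substs, subst]
    · simp only [occ]
      split_ifs <;> omega
    rotate_right
    · simp [stepCost]; omega
    all_goals simp [substs, subst]
  | @pop₃Nil k i f j l r w hP _ ih =>
    rw [runTerm, hP, code]
    refine step ((reducesWithin_case_nil eC (hargs l r []) (fun x => ?_) ?_
      (fun k => ?_) ?_).trans
      (reducesWithin_jump (Ws := []) (by simp) (l := l) (r := r) (u := []) j ?_
        (fun k => ?_) ?_ ?_ ?_)) ?_ ih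
    · exact isClosedValue_lam_jump eI (by decide) (by simp [ClosedAt]) (by simp [ClosedAt])
        (by simp [ClosedAt])
    · exact isClosedValue_lam_jump eI (by decide) (by simp [ClosedAt]) (by simp [ClosedAt])
        (by simp [ClosedAt])
    · simp only [occ, occ_encode, List.map_cons, List.map_nil, List.sum_cons, List.sum_nil]
      split_ifs <;> omega
    · simp [substs, subst]
    · simp [substs, subst]
    · simp only [occ]
      split_ifs <;> omega
    rotate_right
    · simp [stepCost]; omega
    all_goals simp [substs, subst]
  | @pop₃Cons k i f j l r x u w hP _ ih =>
    rw [runTerm, hP, code]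
    refine step ((reducesWithin_case_cons eC (s := u) (hargs l r (x :: u)) (fun x => ?_) ?_
      (fun k => ?_) ?_).trans
      (reducesWithin_jump (hW₃ u) (l := l) (r := r) (u := []) (f x) ?_
        (fun k => ?_) ?_ ?_ ?_)) ?_ ih
    · exact isClosedValue_lam_jump eI (by decide) (by simp [ClosedAt]) (by simp [ClosedAt])
        (by simp [ClosedAt])
    · exact isClosedValue_lam_jump eI (by decide) (by simp [ClosedAt]) (by simp [ClosedAt])
        (by simp [ClosedAt])
    · simp only [occ, occ_encode, List.map_cons, List.map_nil, List.sum_cons, List.sum_nil]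
      split_ifs <;> omega
    · simp [substs, subst]
    · simp [substs, subst]
    · simp only [occ]
      split_ifs <;> omega
    rotate_right
    · simp [stepCost]; omega
    all_goals simp [substs, subst]

end Run

end Term

/-! ### Turing machines as stack programs -/

/-- The labels of the stack program of a Turing machine. -/
inductive Label (S Q D : Type*)
  /-- Simulate a step in state `q` with scanned symbol `a`. -/
  | exec (q : Q) (a : S)
  /-- Fetch the symbol to the left of the head and continue in state `q`. -/
  | readLeft (q : Q)
  /-- Fetch the symbol to the right of the head and continue in state `q`. -/
  | readRight (q : Q)
  /-- Fetch a letter of the unread part of the input and continue in state `q`. -/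
  | readInput (q : Q)
  /-- Move the visited tape to the right of the head onto the stack for the tape to the left. -/
  | unroll
  /-- Put one letter onto the stack for the tape to the left, as part of `unroll`. -/
  | unrollPush (a : S)
  /-- Move the letters in `D` from the first stack onto the third one, and delete the others. -/
  | collect
  /-- Put one letter onto the third stack, as part of `collect`. -/
  | collectPush (d : D)
  /-- Halt, with the output on the third stack. -/
  | finish

theorem finite_label (S Q D : Type*) [Finite S] [Finite Q] [Finite D] : Finite (Label S Q D) := by
  let f : (Q × S) ⊕ (Q × Fin 3) ⊕ S ⊕ D ⊕ Fin 3 → Label S Q D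
    | .inl (q, a) => .exec q a
    | .inr (.inl (q, 0)) => .readLeft q
    | .inr (.inl (q, 1)) => .readRight q
    | .inr (.inl (q, 2)) => .readInput q
    | .inr (.inr (.inl a)) => .unrollPush a
    | .inr (.inr (.inr (.inl d))) => .collectPush d
    | .inr (.inr (.inr (.inr 0))) => .unroll
    | .inr (.inr (.inr (.inr 1))) => .collect
    | .inr (.inr (.inr (.inr 2))) => .finish
  refine Finite.of_surjective f fun x => ?_
  cases x with
  | exec q a => exact ⟨.inl (q, a), rfl⟩
  | readLeft q => exact ⟨.inr (.inl (q, 0)), rfl⟩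
  | readRight q => exact ⟨.inr (.inl (q, 1)), rfl⟩
  | readInput q => exact ⟨.inr (.inl (q, 2)), rfl⟩
  | unroll => exact ⟨.inr (.inr (.inr (.inr 0))), rfl⟩
  | unrollPush a => exact ⟨.inr (.inr (.inl a)), rfl⟩
  | collect => exact ⟨.inr (.inr (.inr (.inr 1))), rfl⟩
  | collectPush d => exact ⟨.inr (.inr (.inr (.inl d))), rfl⟩
  | finish => exact ⟨.inr (.inr (.inr (.inr 2))), rfl⟩

namespace TuringMachine

variable {S Q : Type*} [DecidableEq S]

open Label in
/-- The stack program of a Turing machine. The stacks hold the tape to the left of the head (nearest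
symbol on top), the visited part of the tape to the right of the head, and the rest of the input,
which is still a string over `Δ`. To stay in place is to write to the right and to fetch this
symbol. -/
def program (M : TuringMachine S Q) (Δ : Finset S) : Label S Q Δ → Instr (Label S Q Δ) S S Δ
  | exec q a =>
    match M.δ q a with
    | none => .push₁ a unroll
    | some (p, b, .stay) => .push₂ b (readRight p)
    | some (p, b, .left) => .push₂ b (readLeft p)
    | some (p, b, .right) => .push₁ b (readRight p)
  | readLeft q => .pop₁ (exec q) (exec q M.blank)
  | readRight q => .pop₂ (exec q) (readInput q)
  | readInput q => .pop₃ (fun d => exec q d) (exec q M.blank)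
  | unroll => .pop₂ unrollPush collect
  | unrollPush a => .push₁ a unroll
  | collect => .pop₁ (fun a => if h : a ∈ Δ then collectPush ⟨a, h⟩ else collect) finish
  | collectPush d => .push₃ d collect
  | finish => .halt

variable (M : TuringMachine S Q) (Δ : Finset S)

theorem exec_collect (l : List S) (u : List Δ) : ∃ k ≤ 2 * l.length + 1, ∃ w : List Δ,
    Exec (M.program Δ) k .collect l [] u w ∧
    w.map Subtype.val = l.reverse.filter (· ∈ Δ) ++ u.map Subtype.val := by
  induction l generalizing u with
  | nil => exact ⟨1, by simp, u, .pop₁Nil rfl (.halt rfl), by simp⟩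
  | cons a l ih =>
    by_cases h : a ∈ Δ
    · obtain ⟨k, hk, w, hw, hwu⟩ := ih (⟨a, h⟩ :: u)
      refine ⟨k + 2, by simp; omega, w, .pop₁Cons rfl ?_, by simp [hwu, h]⟩
      rw [dif_pos h]
      exact .push₃ rfl hw
    · obtain ⟨k, hk, w, hw, hwu⟩ := ih u
      refine ⟨k + 1, by simp; omega, w, .pop₁Cons rfl ?_, by simp [hwu, h]⟩
      rwa [dif_neg h]

theorem exec_unroll (l r : List S) (u : List Δ) :
    ∃ k ≤ 2 * l.length + 4 * r.length + 2, ∃ w : List Δ, Exec (M.program Δ) k .unroll l r u w ∧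
    w.map Subtype.val = (l.reverse ++ r).filter (· ∈ Δ) ++ u.map Subtype.val := by
  induction r generalizing l with
  | nil =>
    obtain ⟨k, hk, w, hw, hwu⟩ := M.exec_collect Δ l u
    exact ⟨k + 1, by simp; omega, w, .pop₂Nil rfl hw, by simp [hwu]⟩
  | cons a r ih =>
    obtain ⟨k, hk, w, hw, hwu⟩ := ih (a :: l)
    exact ⟨k + 2, by simp at hk ⊢; omega, w, .pop₂Cons rfl (.push₁ rfl hw), by simp [hwu]⟩

/-- The program simulates a halting computation in linear time. The unread input `u` does not count,
and each step lengthens the visited tape by at most one symbol. -/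
theorem exec_of_evolves {k : ℕ} {C D : Config S Q} (h : M.Evolves k C D)
    (hD : D.state = M.finalState) (r : List S) (u : List Δ)
    (hC : C.right = r ++ u.map Subtype.val) :
    ∃ t ≤ 7 * k + 4 * (C.left.length + r.length) + 5, ∃ w : List Δ,
      Exec (M.program Δ) t (.exec C.state C.head) C.left.reverse r u w ∧
      w.map Subtype.val = (D.left ++ D.head :: D.right).filter (· ∈ Δ) := by
  induction h generalizing r u with
  | refl C =>
    -- The machine has halted: the scanned symbol joins the tape to the left, and the tape is
    -- collected.
    obtain ⟨t, ht, w, hw, hwu⟩ := M.exec_unroll Δ (C.head :: C.left.reverse) r u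
    have hδ : M.δ C.state C.head = none := by
      rw [← Option.not_isSome_iff_eq_none, M.δ_isSome_iff]
      exact not_not_intro hD
    refine ⟨t + 1, by simp at ht ⊢; omega, w, .push₁ (by simp only [program, hδ]) hw, ?_⟩
    have hu : (u.map Subtype.val).filter (· ∈ Δ) = u.map Subtype.val := by
      rw [List.filter_eq_self]
      rintro _ h
      obtain ⟨d, -, rfl⟩ := List.mem_map.mp h
      simp
    conv_lhs => rw [hwu, ← hu, ← List.filter_append]
    rw [hC]
    simp
  | step hs _ ih =>
    cases hs with
    | @stay l v a b q p hδ =>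
      obtain ⟨t, ht, w, hw, hwu⟩ := ih hD r u hC
      refine ⟨t + 2, by simp at ht ⊢; omega, w, ?_, hwu⟩
      exact .push₂ (by simp only [program, hδ]; rfl) (.pop₂Cons rfl hw)
    | @left l v a b c q p hδ =>
      obtain ⟨t, ht, w, hw, hwu⟩ := ih hD (b :: r) u (by simpa using hC)
      refine ⟨t + 2, by simp at ht ⊢; omega, w, ?_, hwu⟩
      refine .push₂ (by simp only [program, hδ]; rfl) ?_
      simp only [List.reverse_append, List.reverse_singleton, List.singleton_append]
      exact .pop₁Cons rfl hw
    | @leftEnd v a b q p hδ =>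
      obtain ⟨t, ht, w, hw, hwu⟩ := ih hD (b :: r) u (by simpa using hC)
      refine ⟨t + 2, by simp at ht ⊢; omega, w, ?_, hwu⟩
      exact .push₂ (by simp only [program, hδ]; rfl) (.pop₁Nil rfl hw)
    | @right l v a b c q p hδ =>
      cases r with
      | cons d r =>
        obtain ⟨rfl, hv⟩ := List.cons.inj hC
        obtain ⟨t, ht, w, hw, hwu⟩ := ih hD r u hv
        refine ⟨t + 2, by simp at ht ⊢; omega, w, ?_, hwu⟩
        refine .push₁ (by simp only [program, hδ]; rfl) (.pop₂Cons rfl ?_)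
        simpa using hw
      | nil =>
        -- The head leaves the visited part of the tape, so the next symbol comes from the input.
        cases u with
        | nil => simp at hC
        | cons d u =>
          obtain ⟨rfl, hv⟩ := List.cons.inj hC
          obtain ⟨t, ht, w, hw, hwu⟩ := ih hD [] u hv
          refine ⟨t + 3, by simp at ht ⊢; omega, w, ?_, hwu⟩
          refine .push₁ (by simp only [program, hδ]; rfl) (.pop₂Nil rfl (.pop₃Cons rfl ?_))
          simpa using hw
    | @rightEnd l a b q p hδ =>
      obtain ⟨rfl, hu⟩ := List.append_eq_nil_iff.mp hC.symm
      obtain rfl := List.map_eq_nil_iff.mp hu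
      obtain ⟨t, ht, w, hw, hwu⟩ := ih hD [] [] rfl
      refine ⟨t + 3, by simp at ht ⊢; omega, w, ?_, hwu⟩
      refine .push₁ (by simp only [program, hδ]; rfl) (.pop₂Nil rfl (.pop₃Nil rfl ?_))
      simpa using hw

theorem exec_of_computesInTime {f : List Δ → List Δ} {g : ℕ → ℕ} (h : M.ComputesInTime Δ f g)
    (u : List Δ) : ∃ t ≤ 7 * g u.length + 6,
      Exec (M.program Δ) t (.readInput M.initialState) [] [] u (f u) := by
  obtain ⟨k, hk, C, hC, hfin, hf⟩ := h u
  have inj : Function.Injective (List.map (Subtype.val : Δ → S)) :=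
    List.map_injective_iff.mpr Subtype.val_injective
  cases u with
  | nil =>
    obtain ⟨t, ht, w, hw, hwu⟩ := M.exec_of_evolves Δ hC hfin [] [] rfl
    rw [hf] at hwu
    obtain rfl := inj hwu
    exact ⟨t + 1, by simp [initialConfig] at ht hk ⊢; omega, .pop₃Nil rfl hw⟩
  | cons a u =>
    obtain ⟨t, ht, w, hw, hwu⟩ := M.exec_of_evolves Δ hC hfin [] u rfl
    rw [hf] at hwu
    obtain rfl := inj hwu
    exact ⟨t + 1, by simp [initialConfig] at ht hk ⊢; omega, .pop₃Cons rfl hw⟩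

open Term in
/-- The simulation, with a term and a constant that depend only on the machine and on `Δ`. -/
theorem exists_reducesWithin [Finite S] [Finite Q] {n : ℕ} (e : Δ ≃ Fin n) :
    ∃ (F : Term) (K : ℕ), ∀ (f : List Δ → List Δ) (g : ℕ → ℕ), M.ComputesInTime Δ f g →
      ∀ u : List Δ, ReducesWithin (K * max 1 (g u.length)) (app F (encode e u))
        (encode e (f u)) := by
  have := finite_label S Q Δ
  let eS := Finite.equivFin S
  let eI := Finite.equivFin (Label S Q Δ)
  let P := M.program Δ
  -- Four arguments of the code at the initial label are supplied in advance; the fifth is the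
  -- input.
  refine ⟨applyAll (code eI eS eS e (P (.readInput M.initialState)))
    [encode eI [], dispatcher eI eS eS e P, encode eS [], encode eS []],
    14 * stepCost eI eS eS e P, fun f g hf u => ?_⟩
  obtain ⟨t, ht, h⟩ := M.exec_of_computesInTime Δ hf u
  -- There are at most `7 * g |u| + 6` instructions.
  refine (reducesWithin_of_exec (eI := eI) (eA := eS) (eB := eS) (eC := e) h).mono ?_
  rw [mul_comm 14, mul_assoc]
  exact Nat.mul_le_mul_left _ (by omega)

end TuringMachine

end LambdaCost

theorem mainTheorem1 {S Q : Type*} [Finite S] [Finite Q] [DecidableEq S]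
    (M : LambdaCost.TuringMachine S Q) (Δ : Finset S) {n : ℕ} (e : Δ ≃ Fin n) :
    ∃ (F : LambdaCost.Term) (K : ℕ), ∀ (f : List Δ → List Δ) (g : ℕ → ℕ),
      M.ComputesInTime Δ f g →
      ∀ u : List Δ, ∃ α : List ℕ,
        LambdaCost.Term.WRed (.app F (LambdaCost.Term.encode e u)) α
          (LambdaCost.Term.encode e (f u)) ∧
        α.sum ≤ K * max 1 (g u.length) := by
  exact M.exists_reducesWithin Δ e
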